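/- Let $\mathcal{H}\in C^1(\mathbb{S}^2)$, where $\mathbb{S}^2\subset\mathbb{R}^3$ is the unit sphere. If $\mathcal{H}$ vanishes at some point of $\mathbb{S}^2$, then there is no closed $\mathcal{H}$-surface in $\mathbb{R}^3$. Here a closed $\mathcal{H}$-surface is a $C^2$ immersion $\psi\colon M\to\mathbb{R}^3$ of a non-empty compact two-dimensional $C^2$ manifold $M$ without boundary, together with a continuous unit normal field $N\colon M\to\mathbb{S}^2$ along $\psi$ (its Gauss map), such that $H_M(p)=\mathcal{H}(N_p)$ for every $p\in M$, where $H_M$ is the mean curvature of $\psi$ with respect to $N$, that is, half the trace of the second fundamental form $\langle\partial_i\partial_j\psi,N\rangle$ with respect to the first fundamental form $\langle\partial_i\psi,\partial_j\psi\rangle$ (so the unit sphere has mean curvature $1$ for the inward normal). Neither embeddedness nor connectedness of $M$ is assumed. -/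

import Mathlib

open scoped Manifold ContDiff

noncomputable section

/-- The Euclidean plane. -/
abbrev E2 : Type := EuclideanSpace ℝ (Fin 2)

/-- Euclidean space `ℝ³`. -/
abbrev E3 : Type := EuclideanSpace ℝ (Fin 3)

/-- The unit sphere `𝕊²` of `ℝ³` (with Mathlib's smooth structure). -/
abbrev S2 : Type := Metric.sphere (0 : E3) 1

/-- First fundamental form `g i j = ⟪∂ᵢf, ∂ⱼf⟫` of a parametrized surface `f` at `x`. -/
def firstForm (f : E2 → E3) (x : E2) : Matrix (Fin 2) (Fin 2) ℝ :=
  Matrix.of fun i j =>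
    inner ℝ (fderiv ℝ f x (EuclideanSpace.single i 1)) (fderiv ℝ f x (EuclideanSpace.single j 1))

/-- Second fundamental form `h i j = ⟪∂ᵢ∂ⱼf, n⟫` of a parametrized surface `f` at `x`, with
respect to the unit normal `n` at `x`. -/
def secondForm (f : E2 → E3) (n : E3) (x : E2) : Matrix (Fin 2) (Fin 2) ℝ :=
  Matrix.of fun i j =>
    inner ℝ (fderiv ℝ (fderiv ℝ f) x (EuclideanSpace.single i 1) (EuclideanSpace.single j 1)) n

/-- Mean curvature `(1/2) tr (g⁻¹ h)` of a parametrized surface `f` at `x` with respect to the unit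
normal `n`: the arithmetic mean of the principal curvatures, positive for a round sphere with the
inward normal. On the graph of `u` with the upward normal it is
`(1/2) div (Du / √(1 + |Du|²))`. -/
def paramMeanCurvature (f : E2 → E3) (n : E3) (x : E2) : ℝ :=
  (1 / 2) * ((firstForm f x)⁻¹ * secondForm f n x).trace

section Surfaces

variable {M : Type*} [TopologicalSpace M] [ChartedSpace E2 M]

/-- Mean curvature at `p` of an immersion `ψ : M → ℝ³` oriented by the unit normal field `N`,
computed in the preferred chart at `p`; for a `C²` immersion any other chart of the
`C²` structure gives the same value. -/
def meanCurvature (ψ : M → E3) (N : M → S2) (p : M) : ℝ :=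
  paramMeanCurvature (ψ ∘ (extChartAt (𝓡 2) p).symm) (N p : E3) (extChartAt (𝓡 2) p p)

/-- `ψ : M → ℝ³` is an immersion of class `C²`, and `N` is a Gauss map of it: a continuous unit
vector field along `ψ` that is normal to the tangent planes. -/
structure IsOrientedImmersion (ψ : M → E3) (N : M → S2) : Prop where
  contMDiff : ContMDiff (𝓡 2) 𝓘(ℝ, E3) 2 ψ
  injective_mfderiv : ∀ p, Function.Injective (mfderiv (𝓡 2) 𝓘(ℝ, E3) ψ p)
  continuous_gauss : Continuous N
  normal : ∀ (p : M) (w : TangentSpace (𝓡 2) p),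
    inner (E := E3) ℝ (mfderiv (𝓡 2) 𝓘(ℝ, E3) ψ p w) (N p : E3) = 0

/-- The immersed surface `ψ : M → ℝ³` with Gauss map `N` is an `H`-surface: its mean curvature is
`H (N p)` at every point `p`. -/
structure IsHSurface (H : S2 → ℝ) (ψ : M → E3) (N : M → S2) : Prop
    extends IsOrientedImmersion ψ N where
  meanCurvature_eq : ∀ p, meanCurvature ψ N p = H (N p)

end Surfaces

end

/-! Let `H v = 0`. At a highest and at a lowest point in direction `v` the normal is `±v`, and the
second-order conditions restrict the sign of `H` there. In every case some extremal point `p` has `H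
(N p) = 0`: if both normals are `-v`, the two signs force `H (-v) = 0`.

Near such a `p` a strong maximum principle makes the height constant
(`IsHSurface.eventually_eq_of_max`). No elliptic equation is written down. Following Hopf, a small
Gaussian barrier is added to the height, and `gaussian_touching` gives the normal and a curvature
inequality at a local maximum of the sum. As `H` is C¹ and vanishes at `N p`, it is at most linear
in the tilt of the normal (`exists_gnomonic_bound`), so a steep Gaussian excludes such maxima;
`eqOn_zero_of_no_gaussian_max` concludes.

Hence the points of extremal height with normal `N p` form an open and compact set. A horizontal
coordinate attains a maximum on it, which is a local maximum on `M`, so the normal there is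
horizontal, whereas `N p = ±v`. Connectedness plays no role. -/

open Filter Topology Set Metric

/-! ### Second-order conditions at a local maximum -/

/-- Second order necessary condition at a local maximum of a function of one variable. -/
theorem IsLocalMax.second_deriv_nonpos {φ φ' : ℝ → ℝ} {c x : ℝ}
    (hφ : ∀ᶠ t in 𝓝 x, HasDerivAt φ (φ' t) t) (hφ' : HasDerivAt φ' c x)
    (hmax : IsLocalMax φ x) : c ≤ 0 := by
  by_contra! hc
  have hd : deriv φ =ᶠ[𝓝 x] φ' := hφ.mono fun t ht => ht.deriv
  have hdd : deriv (deriv φ) x = c := by rw [hd.deriv_eq, hφ'.deriv]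
  -- If `c > 0`, then `x` is also a local minimum, so `φ` is locally constant and `c = 0`.
  have hmin : IsLocalMin φ x :=
    isLocalMin_of_deriv_deriv_pos (by rwa [hdd]) hmax.deriv_eq_zero hφ.self_of_nhds.continuousAt
  have hconst : φ =ᶠ[𝓝 x] fun _ => φ x := by
    filter_upwards [hmin, hmax] with t h₁ h₂ using le_antisymm h₂ h₁
  have : deriv (deriv φ) x = 0 := by
    rw [hconst.deriv.deriv_eq]
    simp
  linarith

/-- First and second order conditions at a local maximum of a linear function plus a Gaussian
barrier along a `C²` map. -/
theorem IsLocalMax.linear_add_gaussian {E F K : Type*} [NormedAddCommGroup E] [NormedSpace ℝ E]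
    [NormedAddCommGroup F] [InnerProductSpace ℝ F] [NormedAddCommGroup K] [InnerProductSpace ℝ K]
    {f : E → F} {a : E} (hf : ContDiffAt ℝ 2 f a) (P : F →L[ℝ] K) (v : F) (y : K) (α ε : ℝ)
    (hmax : IsLocalMax
      (fun x => inner ℝ (f x) v + ε * Real.exp (-α * ‖P (f x) - y‖ ^ 2)) a) (u : E) :
    (inner ℝ (fderiv ℝ f a u) v - 2 * α * (ε * Real.exp (-α * ‖P (f a) - y‖ ^ 2)) *
        inner ℝ (P (fderiv ℝ f a u)) (P (f a) - y) = 0) ∧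
      inner ℝ (fderiv ℝ (fderiv ℝ f) a u u) v +
        ε * Real.exp (-α * ‖P (f a) - y‖ ^ 2) *
          (4 * α ^ 2 * inner ℝ (P (fderiv ℝ f a u)) (P (f a) - y) ^ 2 -
            2 * α * (‖P (fderiv ℝ f a u)‖ ^ 2 +
              inner ℝ (P (fderiv ℝ (fderiv ℝ f) a u u)) (P (f a) - y))) ≤ 0 := by
  have hline (t : ℝ) : HasDerivAt (fun t : ℝ => a + t • u) u t := by
    simpa using ((hasDerivAt_id t).smul_const u).const_add a
  have hf1 : ∀ᶠ t : ℝ in 𝓝 0,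
      HasDerivAt (fun t : ℝ => f (a + t • u)) (fderiv ℝ f (a + t • u) u) t := by
    have h1 : ∀ᶠ x in 𝓝 a, DifferentiableAt ℝ f x := by
      filter_upwards [hf.eventually (by simp)] with x hx using hx.differentiableAt (by simp)
    have h2 : Tendsto (fun t : ℝ => a + t • u) (𝓝 0) (𝓝 a) := by
      simpa using (hline 0).continuousAt.tendsto
    filter_upwards [h2.eventually h1] with t ht
    exact ht.hasFDerivAt.comp_hasDerivAt t (hline t)
  have hf2 : HasDerivAt (fun t : ℝ => fderiv ℝ f (a + t • u) u)
      (fderiv ℝ (fderiv ℝ f) a u u) 0 := by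
    have h1 : DifferentiableAt ℝ (fderiv ℝ f) a :=
      (hf.fderiv_right (m := 1) (by norm_num)).differentiableAt (by simp)
    have h2 : HasFDerivAt (fderiv ℝ f) (fderiv ℝ (fderiv ℝ f) a) (a + (0 : ℝ) • u) := by
      simpa using h1.hasFDerivAt
    have h3 := h2.comp_hasDerivAt (0 : ℝ) (hline 0)
    simpa using h3.clm_apply (hasDerivAt_const (0 : ℝ) u)
  set g : ℝ → F := fun t => f (a + t • u) with hg
  set g' : ℝ → F := fun t => fderiv ℝ f (a + t • u) u with hg'
  set w : ℝ → ℝ := fun t => ε * Real.exp (-α * ‖P (g t) - y‖ ^ 2) with hw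
  have hw1 (t : ℝ) (ht : HasDerivAt g (g' t) t) :
      HasDerivAt w (-(2 * α) * (w t * inner ℝ (P (g' t)) (P (g t) - y))) t := by
    have h1 : HasDerivAt (fun t => P (g t) - y) (P (g' t)) t :=
      (P.hasFDerivAt.comp_hasDerivAt t ht).sub_const y
    have h2 := (((h1.norm_sq).const_mul (-α)).exp).const_mul ε
    convert! h2 using 1
    rw [real_inner_comm]
    simp only [hw]
    ring
  set φ : ℝ → ℝ := fun t => inner ℝ (g t) v + w t with hφ
  set φ' : ℝ → ℝ := fun t =>
    inner ℝ (g' t) v + -(2 * α) * (w t * inner ℝ (P (g' t)) (P (g t) - y)) with hφ'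
  have hφ1 : ∀ᶠ t in 𝓝 0, HasDerivAt φ (φ' t) t := by
    filter_upwards [hf1] with t ht
    refine HasDerivAt.add ?_ (hw1 t ht)
    simpa using ht.inner ℝ (hasDerivAt_const t v)
  have h0 : HasDerivAt g (g' 0) 0 := hf1.self_of_nhds
  have hP1 : HasDerivAt (fun t => P (g t) - y) (P (g' 0)) 0 :=
    (P.hasFDerivAt.comp_hasDerivAt 0 h0).sub_const y
  have hP2 := P.hasFDerivAt.comp_hasDerivAt (0 : ℝ) hf2
  have hφ2 := HasDerivAt.add (by simpa using hf2.inner ℝ (hasDerivAt_const 0 v))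
    (((hw1 0 h0).mul (hP2.inner ℝ hP1)).const_mul (-(2 * α)))
  have hmax' : IsLocalMax φ 0 := by
    have h2 : Tendsto (fun t : ℝ => a + t • u) (𝓝 0) (𝓝 a) := by
      simpa using (hline 0).continuousAt.tendsto
    have h3 := h2.eventually hmax
    simpa [IsLocalMax, IsMaxFilter, hφ, hg, hw] using h3
  have c1 := hφ1.self_of_nhds.deriv.symm.trans hmax'.deriv_eq_zero
  have c2 := IsLocalMax.second_deriv_nonpos hφ1 hφ2 hmax'
  have e0 : a + (0 : ℝ) • u = a := by simp
  simp only [hφ', hg, hg', hw, e0, Function.comp_def, real_inner_self_eq_norm_sq] at c1 c2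
  constructor
  · linarith
  · refine le_of_eq_of_le ?_ c2
    ring

/-! ### Hopf's barrier argument -/

/-- Hopf's touching argument: a nonpositive continuous function on a ball which vanishes at the
centre, and which has no interior maximum when a small Gaussian barrier is added, vanishes near the
centre. -/
theorem eqOn_zero_of_no_gaussian_max {K : Type*} [NormedAddCommGroup K] [InnerProductSpace ℝ K]
    [ProperSpace K] {u : K → ℝ} {x₀ : K} {ρ : ℝ} (hρ : 0 < ρ)
    (hcont : ContinuousOn u (ball x₀ ρ)) (hle : ∀ x ∈ ball x₀ ρ, u x ≤ 0) (h0 : u x₀ = 0)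
    (hno : ∀ (y : K) (R : ℝ), 0 < R → ∃ α > 0, ∃ ε₀ > 0, ∀ ε, 0 < ε → ε < ε₀ → ∀ x ∈ ball x₀ ρ,
      R / 2 ≤ ‖x - y‖ → ‖x - y‖ ≤ 3 * R / 2 →
        ¬ IsLocalMax (fun z => u z + ε * Real.exp (-α * ‖z - y‖ ^ 2)) x) :
    ∀ x ∈ ball x₀ (ρ / 4), u x = 0 := by
  intro x₁ hx₁
  by_contra hne
  have hx₁ρ : dist x₁ x₀ < ρ / 4 := hx₁
  have hcb : closedBall x₀ (ρ / 2) ⊆ ball x₀ ρ := closedBall_subset_ball (by linarith)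
  -- the zero of `u` nearest to `x₁`
  set Z : Set K := closedBall x₀ (ρ / 2) ∩ u ⁻¹' {0} with hZ
  have hZc : IsCompact Z :=
    (isCompact_closedBall _ _).of_isClosed_subset
      ((hcont.mono hcb).preimage_isClosed_of_isClosed isClosed_closedBall isClosed_singleton)
      inter_subset_left
  have hx₀Z : x₀ ∈ Z := ⟨mem_closedBall_self (by linarith), h0⟩
  obtain ⟨z, hzZ, hz⟩ := hZc.exists_infDist_eq_dist ⟨x₀, hx₀Z⟩ x₁
  have hmin (q : K) (hq : q ∈ Z) : dist x₁ z ≤ dist x₁ q := hz ▸ infDist_le_dist_of_mem hq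
  have hz0 : u z = 0 := hzZ.2
  have hd₀ : dist x₁ z ≤ dist x₁ x₀ := hmin _ hx₀Z
  have hdpos : 0 < dist x₁ z := by
    refine dist_pos.2 ?_
    rintro rfl
    exact hne hz0
  -- The ball about `x₁` through `z` may have other zeros on its boundary; the half-size ball
  -- tangent to it at `z` meets the zero set only at `z`.
  set y : K := midpoint ℝ x₁ z with hy
  set R : ℝ := dist x₁ z / 2 with hR
  have hRpos : 0 < R := by positivity
  have hyz : dist z y = R := by
    rw [dist_comm, hy, dist_midpoint_right]; norm_num; rw [hR]; ring
  have hyx : dist y x₁ = R := by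
    rw [hy, dist_midpoint_left]; norm_num; rw [hR]; ring
  have hneg (q : K) (hq : dist q y ≤ R) (hqz : q ≠ z) : u q < 0 := by
    have hlt : dist q x₁ < dist x₁ z := by
      refine lt_of_le_of_ne ?_ ?_
      · linarith [dist_triangle q y x₁]
      · intro heq
        apply hqz
        -- Equality in the triangle inequality makes `y` the midpoint of `q` and `x₁`, so `q = z`.
        have h1 : dist q y + dist y x₁ = dist q x₁ := by
          apply le_antisymm _ (dist_triangle _ _ _)
          rw [hyx, heq]; linarith
        have h2 : dist q y = R := by linarith
        have h3 : dist q y = dist q x₁ / 2 := by rw [h2, heq]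
        have : y = midpoint ℝ q x₁ := by
          apply eq_midpoint_of_dist_eq_half h3
          rw [hyx, heq]
        rw [hy, midpoint_comm, midpoint_eq_midpoint_iff_vsub_eq_vsub] at this
        simpa [sub_eq_zero, eq_comm] using this
    have hqb : dist q x₀ ≤ ρ / 2 := by linarith [dist_triangle q x₁ x₀]
    refine lt_of_le_of_ne (hle _ (hcb hqb)) fun h => ?_
    have := hmin q ⟨hqb, h⟩
    rw [dist_comm] at hlt
    linarith
  obtain ⟨α, hα, ε₀, hε₀, H⟩ := hno y R hRpos
  have hzx : dist z x₀ ≤ ρ / 2 := hzZ.1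
  have hDb : closedBall z (R / 2) ⊆ ball x₀ ρ := by
    intro q hq
    have : dist q z ≤ R / 2 := hq
    have := dist_triangle q z x₀
    change dist q x₀ < ρ
    linarith
  -- `u` is bounded away from zero on the part of the small sphere inside the tangent ball
  obtain ⟨m, hm, hmu⟩ : ∃ m > 0, ∀ q ∈ sphere z (R / 2) ∩ closedBall y R, u q ≤ -m := by
    have hSc : IsCompact (sphere z (R / 2) ∩ closedBall y R) :=
      (isCompact_sphere _ _).inter_right isClosed_closedBall
    rcases (sphere z (R / 2) ∩ closedBall y R).eq_empty_or_nonempty with he | hnon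
    · exact ⟨1, one_pos, by simp [he]⟩
    · obtain ⟨q, hq, hqm⟩ := hSc.exists_isMaxOn hnon
        (hcont.mono fun q hq => hDb (sphere_subset_closedBall hq.1))
      refine ⟨-u q, ?_, fun q' hq' => by simpa using hqm hq'⟩
      have : u q < 0 := hneg q hq.2 (by
        rintro rfl
        have := hq.1
        simp at this
        linarith)
      linarith
  set ε : ℝ := min (ε₀ / 2) (m / 2) with hε
  have hεpos : 0 < ε := by positivity
  have hεlt : ε < ε₀ := by linarith [min_le_left (ε₀ / 2) (m / 2)]
  have hεm : ε < m := by linarith [min_le_right (ε₀ / 2) (m / 2)]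
  set F : K → ℝ := fun x => u x + ε * Real.exp (-α * ‖x - y‖ ^ 2) with hF
  have hFc : ContinuousOn F (closedBall z (R / 2)) :=
    (hcont.mono hDb).add (Continuous.continuousOn (by fun_prop))
  obtain ⟨q, hqD, hqmax⟩ := (isCompact_closedBall z (R / 2)).exists_isMaxOn
    ⟨z, mem_closedBall_self (by positivity)⟩ hFc
  have hFz : F z = ε * Real.exp (-α * R ^ 2) := by
    simp only [hF, hz0, zero_add, ← dist_eq_norm, hyz]
  -- On the boundary, inside the tangent ball `u ≤ -m < -ε` outweighs the barrier; outside it `u ≤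
  -- 0` and the barrier is smaller than at `z`.
  have hqint : q ∈ ball z (R / 2) := by
    by_contra hqb
    have hqs : q ∈ sphere z (R / 2) := by
      refine le_antisymm hqD ?_
      simpa using hqb
    have hzq : F z ≤ F q := hqmax (mem_closedBall_self (by positivity))
    rw [hFz] at hzq
    have hexp := Real.exp_pos (-α * R ^ 2)
    by_cases hin : dist q y ≤ R
    · have h1 := hmu q ⟨hqs, hin⟩
      have h2 : Real.exp (-α * ‖q - y‖ ^ 2) ≤ 1 := by
        rw [Real.exp_le_one_iff]
        nlinarith [sq_nonneg ‖q - y‖]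
      have h3 : F q < 0 := by
        simp only [hF]
        nlinarith
      have : 0 < ε * Real.exp (-α * R ^ 2) := by positivity
      linarith
    · push Not at hin
      have h1 : u q ≤ 0 := hle q (hDb hqD)
      have h2 : Real.exp (-α * ‖q - y‖ ^ 2) < Real.exp (-α * R ^ 2) := by
        rw [Real.exp_lt_exp, ← dist_eq_norm]
        have : R ^ 2 < dist q y ^ 2 := by gcongr
        nlinarith
      have h3 : F q < ε * Real.exp (-α * R ^ 2) := by
        simp only [hF]
        nlinarith
      linarith
  have hloc : IsLocalMax F q :=
    (hqmax.on_subset ball_subset_closedBall).isLocalMax (isOpen_ball.mem_nhds hqint)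
  have hqz : dist q z < R / 2 := hqint
  refine H ε hεpos hεlt q (hDb hqD) ?_ ?_ hloc
  · rw [← dist_eq_norm]
    have := dist_triangle z q y
    rw [dist_comm z q] at this
    linarith
  · rw [← dist_eq_norm]
    linarith [dist_triangle q z y]

/-! ### Traces and Gram matrices -/

/-- The trace of a negative semidefinite form with respect to a positive definite one is
nonpositive. -/
theorem trace_inv_mul_nonpos {g S : Matrix (Fin 2) (Fin 2) ℝ} (hg : g.PosDef)
    (hS : ∀ a b : ℝ, a ^ 2 * S 0 0 + a * b * (S 0 1 + S 1 0) + b ^ 2 * S 1 1 ≤ 0) :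
    (g⁻¹ * S).trace ≤ 0 := by
  have hdet : 0 < g.det := hg.det_pos
  have h00 : 0 < g 0 0 := hg.diag_pos
  have hsymm : g 1 0 = g 0 1 := by simpa using hg.isHermitian.apply 0 1
  have htr : (g⁻¹ * S).trace =
      g.det⁻¹ * (g 1 1 * S 0 0 - g 0 1 * (S 0 1 + S 1 0) + g 0 0 * S 1 1) := by
    rw [Matrix.inv_def, Ring.inverse_eq_inv', Matrix.adjugate_fin_two]
    simp only [Matrix.trace, Matrix.mul_apply, Fin.sum_univ_two, Matrix.diag, Matrix.smul_apply,
      Matrix.of_apply, Matrix.cons_val', Matrix.cons_val_zero, Matrix.cons_val_one,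
      Matrix.cons_val_fin_one, hsymm, smul_eq_mul]
    ring
  rw [htr]
  refine mul_nonpos_of_nonneg_of_nonpos (by positivity) ?_
  -- This vector is `g`-orthogonal to the first basis vector; `g 0 0` times the bracket is `g.det *
  -- S 0 0` plus the form's value at it.
  have h1 := hS (-g 0 1) (g 0 0)
  have h2 : S 0 0 ≤ 0 := by simpa using hS 1 0
  rw [Matrix.det_fin_two, hsymm] at hdet
  have h3 := mul_nonpos_of_nonneg_of_nonpos hdet.le h2
  by_contra! hpos
  nlinarith [mul_pos h00 hpos]

/-- Decomposition along a basis of a plane and a unit normal. -/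
theorem exists_decomposition {X : Fin 2 → E3} (hX : LinearIndependent ℝ X) {N : E3}
    (hN : ‖N‖ = 1) (hXN : ∀ i, inner ℝ (X i) N = 0) (ξ : E3) :
    ∃ a b s : ℝ, ξ = a • X 0 + b • X 1 + s • N := by
  have hNN : inner ℝ N N = (1 : ℝ) := by simp [hN]
  have hli : LinearIndependent ℝ ![X 0, X 1, N] := by
    rw [Fintype.linearIndependent_iff] at hX ⊢
    intro c hc
    simp only [Fin.sum_univ_three, Matrix.cons_val_zero, Matrix.cons_val_one,
      Matrix.cons_val] at hc
    have hN0 : N ≠ 0 := by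
      rintro rfl
      simp at hN
    have h2 : c 2 = 0 := by
      have := congrArg (fun z => inner ℝ z N) hc
      simpa [inner_add_left, inner_smul_left, hXN, hNN, hN0] using this
    have h01 := hX ![c 0, c 1] (by simpa [Fin.sum_univ_two, h2] using hc)
    intro i
    fin_cases i
    · simpa using h01 0
    · simpa using h01 1
    · simpa using h2
  have hspan := hli.span_eq_top_of_card_eq_finrank (by simp)
  have hmem : ξ ∈ Submodule.span ℝ (range ![X 0, X 1, N]) := hspan ▸ Submodule.mem_top
  obtain ⟨c, hc⟩ := (Submodule.mem_span_range_iff_exists_fun ℝ).1 hmem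
  exact ⟨c 0, c 1, c 2, by simpa [Fin.sum_univ_three] using hc.symm⟩

/-- A vector orthogonal to a plane is a multiple of its unit normal. -/
theorem exists_eq_smul_normal {X : Fin 2 → E3} (hX : LinearIndependent ℝ X) {N : E3}
    (hN : ‖N‖ = 1) (hXN : ∀ i, inner ℝ (X i) N = 0) {ξ : E3} (hξ : ∀ i, inner ℝ (X i) ξ = 0) :
    ∃ μ : ℝ, ξ = μ • N := by
  obtain ⟨a, b, s, h⟩ := exists_decomposition hX hN hXN ξ
  refine ⟨s, ?_⟩
  have hd : ξ - s • N = a • X 0 + b • X 1 := by rw [h]; abel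
  rw [← sub_eq_zero, ← inner_self_eq_zero (𝕜 := ℝ)]
  nth_rw 1 [hd]
  simp [inner_add_left, inner_smul_left, inner_sub_right, inner_smul_right, hXN, hξ]

/-- The squared length of the tangential part of a vector, as a trace. -/
theorem trace_inv_gram_mul {X : Fin 2 → E3} (hX : LinearIndependent ℝ X) {N : E3}
    (hN : ‖N‖ = 1) (hXN : ∀ i, inner ℝ (X i) N = 0) (ξ : E3) :
    ((Matrix.gram ℝ X)⁻¹ * Matrix.of fun i j => inner ℝ (X i) ξ * inner ℝ (X j) ξ).trace =
      ‖ξ‖ ^ 2 - inner ℝ ξ N ^ 2 := by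
  have hdet : (Matrix.gram ℝ X).det ≠ 0 :=
    (Matrix.posDef_gram_of_linearIndependent hX).det_pos.ne'
  obtain ⟨a, b, s, rfl⟩ := exists_decomposition hX hN hXN ξ
  have hNN : inner ℝ N N = (1 : ℝ) := by simp [hN]
  have hNX (i) : inner ℝ N (X i) = (0 : ℝ) := by rw [real_inner_comm, hXN]
  have h10 : inner ℝ (X 1) (X 0) = (inner ℝ (X 0) (X 1) : ℝ) := real_inner_comm _ _
  rw [← real_inner_self_eq_norm_sq, Matrix.inv_def, Ring.inverse_eq_inv', Matrix.adjugate_fin_two]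
  rw [Matrix.det_fin_two] at hdet ⊢
  simp only [Matrix.gram_apply, h10] at hdet ⊢
  simp only [Matrix.trace, Matrix.mul_apply, Fin.sum_univ_two, Matrix.diag, Matrix.smul_apply,
    Matrix.of_apply, Matrix.cons_val', Matrix.cons_val_zero, Matrix.cons_val_one,
    Matrix.cons_val_fin_one, inner_add_left, inner_add_right, inner_smul_left, inner_smul_right,
    hXN, hNX, hNN, h10, smul_eq_mul, RCLike.conj_to_real]
  generalize inner ℝ (X 0) (X 0) = p at *
  generalize inner ℝ (X 0) (X 1) = q at *
  generalize inner ℝ (X 1) (X 1) = r at *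
  obtain ⟨d, hd⟩ : ∃ d, d = p * r - q * q := ⟨_, rfl⟩
  rw [← hd] at hdet ⊢
  field_simp
  rw [hd]
  ring

theorem trace_inv_mul_gram {X : Fin 2 → E3} (hX : LinearIndependent ℝ X) :
    ((Matrix.gram ℝ X)⁻¹ * Matrix.gram ℝ X).trace = 2 := by
  rw [Matrix.nonsing_inv_mul _
    (Matrix.posDef_gram_of_linearIndependent hX).det_pos.ne'.isUnit]
  simp

/-- The derivative of an immersion maps the standard basis to independent vectors. -/
theorem linearIndependent_partial {L : E2 →L[ℝ] E3} (hL : Function.Injective L) :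
    LinearIndependent ℝ fun i : Fin 2 => L (EuclideanSpace.single i 1) := by
  have h := (EuclideanSpace.basisFun (Fin 2) ℝ).toBasis.linearIndependent.map'
    (L : E2 →ₗ[ℝ] E3) (LinearMap.ker_eq_bot.2 hL)
  convert! h using 1
  ext i : 1
  simp

theorem norm_sq_projection_orthogonal {v : E3} (hv : ‖v‖ = 1) (z : E3) :
    ‖(ℝ ∙ v)ᗮ.orthogonalProjectionOnto z‖ ^ 2 = ‖z‖ ^ 2 - inner ℝ z v ^ 2 := by
  have h1 := Submodule.norm_sq_eq_add_norm_sq_starProjection z (ℝ ∙ v)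
  rw [Submodule.starProjection_unit_singleton ℝ hv, norm_smul, hv, mul_one, Real.norm_eq_abs,
    sq_abs, real_inner_comm] at h1
  have h2 : ‖(ℝ ∙ v)ᗮ.orthogonalProjectionOnto z‖ = ‖(ℝ ∙ v)ᗮ.starProjection z‖ := rfl
  rw [h2]
  linarith

/-! ### The touching inequality and the bound on `H` -/

/-- First and second order information at a point where an immersed surface touches a level set of
a linear function plus a cylindrical Gaussian barrier. -/
theorem gaussian_touching {f : E2 → E3} {a : E2} (hf : ContDiffAt ℝ 2 f a)
    (hinj : Function.Injective (fderiv ℝ f a)) {N v : E3} (hN : ‖N‖ = 1) (hv : ‖v‖ = 1)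
    (hnormal : ∀ u, inner ℝ (fderiv ℝ f a u) N = 0) (y : (ℝ ∙ v)ᗮ) (α ε : ℝ)
    (hmax : IsLocalMax (fun x => inner ℝ (f x) v +
      ε * Real.exp (-α * ‖(ℝ ∙ v)ᗮ.orthogonalProjectionOnto (f x) - y‖ ^ 2)) a)
    {ξ : E3} (hξ : ξ = ((ℝ ∙ v)ᗮ.orthogonalProjectionOnto (f a) - y : (ℝ ∙ v)ᗮ)) {t : ℝ}
    (ht : t = 2 * α * (ε *
      Real.exp (-α * ‖(ℝ ∙ v)ᗮ.orthogonalProjectionOnto (f a) - y‖ ^ 2))) :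
    ∃ μ : ℝ, v - t • ξ = μ • N ∧
      t * (2 * α * (‖ξ‖ ^ 2 - inner ℝ ξ N ^ 2) - (1 + inner ℝ v N ^ 2)) +
        2 * μ * paramMeanCurvature f N a ≤ 0 := by
  set P := (ℝ ∙ v)ᗮ.orthogonalProjectionOnto with hP
  have hPξ (z : E3) : inner ℝ (P z) (P (f a) - y) = inner ℝ z ξ := by
    rw [hξ, Submodule.inner_orthogonalProjectionOnto_eq_of_mem_right]
  have key := IsLocalMax.linear_add_gaussian hf P v y α ε hmax
  set X : Fin 2 → E3 := fun i => fderiv ℝ f a (EuclideanSpace.single i 1) with hXdef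
  have hX : LinearIndependent ℝ X := linearIndependent_partial hinj
  have hXN (i) : inner ℝ (X i) N = 0 := hnormal _
  have hgrad (u : E2) : inner ℝ (fderiv ℝ f a u) (v - t • ξ) = 0 := by
    have := (key u).1
    rw [hPξ, ← ht] at this
    rw [inner_sub_right, inner_smul_right, this]
  obtain ⟨μ, hμ⟩ := exists_eq_smul_normal hX hN hXN fun i => hgrad _
  refine ⟨μ, hμ, ?_⟩
  set h := secondForm f N a with hh
  -- Matrix of the second-order condition: `v - t • ξ = μ • N` turns the second derivatives into `μ
  -- • h`, and projecting off `v` subtracts the last rank-one term from the Gram matrix.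
  set S : Matrix (Fin 2) (Fin 2) ℝ := μ • h +
    (t * (2 * α)) • (Matrix.of fun i j => inner ℝ (X i) ξ * inner ℝ (X j) ξ) -
    t • Matrix.gram ℝ X + t • (Matrix.of fun i j => inner ℝ (X i) v * inner ℝ (X j) v) with hS
  have hquad (b c : ℝ) :
      b ^ 2 * S 0 0 + b * c * (S 0 1 + S 1 0) + c ^ 2 * S 1 1 ≤ 0 := by
    have h2 := (key (b • EuclideanSpace.single 0 1 + c • EuclideanSpace.single 1 1)).2
    rw [hPξ, hPξ, norm_sq_projection_orthogonal hv] at h2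
    refine le_of_eq_of_le ?_ h2
    set D := fderiv ℝ (fderiv ℝ f) a
    set u : E2 := b • EuclideanSpace.single 0 1 + c • EuclideanSpace.single 1 1 with hu
    have h3 : inner ℝ (D u u) v - t * inner ℝ (D u u) ξ = μ * inner ℝ (D u u) N := by
      rw [← inner_smul_right _ _ μ, ← hμ, inner_sub_right, inner_smul_right]
    have h4 : inner ℝ (D u u) N = b ^ 2 * h 0 0 + b * c * (h 0 1 + h 1 0) + c ^ 2 * h 1 1 := by
      simp only [hu, hh, secondForm, Matrix.of_apply, map_add, map_smul, add_apply,
        smul_apply, inner_add_left, inner_smul_left,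
        RCLike.conj_to_real]
      ring
    have h5 : fderiv ℝ f a u = b • X 0 + c • X 1 := by simp [hu, hXdef]
    have h10 : inner ℝ (X 1) (X 0) = (inner ℝ (X 0) (X 1) : ℝ) := real_inner_comm _ _
    have h6 : ‖b • X 0 + c • X 1‖ ^ 2 = b ^ 2 * inner ℝ (X 0) (X 0) +
        2 * b * c * inner ℝ (X 0) (X 1) + c ^ 2 * inner ℝ (X 1) (X 1) := by
      rw [← real_inner_self_eq_norm_sq]
      simp only [inner_add_left, inner_add_right, inner_smul_left, inner_smul_right, h10,
        RCLike.conj_to_real]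
      ring
    rw [h5, h6]
    simp only [inner_add_left, inner_smul_left, RCLike.conj_to_real]
    rw [h4] at h3
    simp only [hS, Matrix.add_apply, Matrix.sub_apply, Matrix.smul_apply, Matrix.of_apply,
      Matrix.gram_apply, smul_eq_mul, h10]
    rw [ht] at h3 ⊢
    linear_combination -h3
  have htr := trace_inv_mul_nonpos (Matrix.posDef_gram_of_linearIndependent hX) hquad
  have hH : paramMeanCurvature f N a = (1 / 2) * ((Matrix.gram ℝ X)⁻¹ * h).trace := rfl
  rw [hH]
  refine le_of_eq_of_le ?_ htr
  rw [hS, Matrix.mul_add, Matrix.mul_sub, Matrix.mul_add]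
  simp only [Matrix.mul_smul, Matrix.trace_add, Matrix.trace_sub, Matrix.trace_smul, smul_eq_mul]
  rw [trace_inv_gram_mul hX hN hXN, trace_inv_gram_mul hX hN hXN, trace_inv_mul_gram hX, hv]
  ring

/-- A `C¹` function on the sphere vanishing at `n` is bounded linearly in the gnomonic coordinate
centred at `n`. -/
theorem exists_gnomonic_bound {H : S2 → ℝ} (hH : ContMDiff (𝓡 2) 𝓘(ℝ, ℝ) 1 H) {n : S2}
    (hn : H n = 0) :
    ∃ C ≥ 0, ∃ δ > 0, ∀ (N : S2) (z : E3) (k : ℝ), ‖z‖ < δ → inner ℝ z (n : E3) = 0 → 0 < k →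
      (n : E3) + z = k • (N : E3) → |H N| ≤ C * ‖z‖ := by
  have hnn : ‖(n : E3)‖ = 1 := norm_eq_of_mem_sphere n
  -- Projection to the affine tangent plane at `n`. As `inner ℝ (l x) n = 1`, radial projection to
  -- the sphere is C¹ on all of `E3`, and differentiability at `0` gives the bound.
  set l : E3 → E3 := fun x => n + (x - (inner ℝ x (n : E3) : ℝ) • (n : E3)) with hl
  have hl0 (x : E3) : l x ≠ 0 := by
    intro h
    have := congrArg (fun z => inner ℝ z (n : E3)) h
    simp [hl, inner_add_left, inner_sub_left, inner_smul_left, hnn] at this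
  have hlc : ContDiff ℝ 1 l :=
    contDiff_const.add (contDiff_id.sub ((contDiff_id.inner ℝ contDiff_const).smul contDiff_const))
  set r : E3 → E3 := fun x => ‖l x‖⁻¹ • l x with hr
  have hrc : ContDiff ℝ 1 r := ((hlc.norm ℝ hl0).inv fun x => norm_ne_zero_iff.2 (hl0 x)).smul hlc
  have hrS (x : E3) : r x ∈ sphere (0 : E3) 1 := by
    simp [hr, norm_smul, hl0 x]
  have : Fact (Module.finrank ℝ E3 = 2 + 1) := ⟨by simp⟩
  have hcomp : ContMDiff 𝓘(ℝ, E3) 𝓘(ℝ, ℝ) 1 (H ∘ Set.codRestrict r _ hrS) :=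
    hH.comp (hrc.contMDiff.codRestrict_sphere hrS)
  have hr0 : Set.codRestrict r _ hrS 0 = n := by
    ext1
    simp [hr, hl, hnn]
  have hdiff : DifferentiableAt ℝ (H ∘ Set.codRestrict r _ hrS) 0 :=
    (hcomp.contDiff.differentiable (by simp)) 0
  obtain ⟨C, hC⟩ := hdiff.hasFDerivAt.isBigO_sub.bound
  obtain ⟨δ, hδ, hball⟩ := Metric.eventually_nhds_iff.1 hC
  refine ⟨max C 0, le_max_right _ _, δ, hδ, fun N z k hz hzn hk heq => ?_⟩
  have hrz : Set.codRestrict r _ hrS z = N := by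
    ext1
    have hlz : l z = k • (N : E3) := by rw [← heq]; simp [hl, hzn]
    have hNN : ‖(N : E3)‖ = 1 := norm_eq_of_mem_sphere N
    simp [hr, hlz, norm_smul, hNN, smul_smul, abs_of_pos hk, hk.ne']
  have h1 := hball (y := z) (by simpa using hz)
  simp only [Function.comp_apply, hrz, hr0, hn, sub_zero, Real.norm_eq_abs] at h1
  exact h1.trans (mul_le_mul_of_nonneg_right (le_max_left _ _) (norm_nonneg _))

/-! ### Immersed surfaces in charts -/

section

variable {M : Type*} [TopologicalSpace M] [ChartedSpace E2 M] {ψ : M → E3} {N : M → S2}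

theorem ContMDiff.contDiffAt_chart (h : ContMDiff (𝓡 2) 𝓘(ℝ, E3) 2 ψ) (q : M) :
    ContDiffAt ℝ 2 (ψ ∘ (extChartAt (𝓡 2) q).symm) (extChartAt (𝓡 2) q q) := by
  have := (contMDiffAt_iff.1 (h q)).2
  simpa [contDiffWithinAt_univ, chartAt_self_eq, Function.comp_def] using this

theorem ContMDiff.mfderiv_eq_fderiv_chart (h : ContMDiff (𝓡 2) 𝓘(ℝ, E3) 2 ψ) (q : M) :
    mfderiv (𝓡 2) 𝓘(ℝ, E3) ψ q =
      fderiv ℝ (ψ ∘ (extChartAt (𝓡 2) q).symm) (extChartAt (𝓡 2) q q) := by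
  rw [(h.mdifferentiable (by simp) q).mfderiv]
  simp [writtenInExtChartAt, chartAt_self_eq, Function.comp_def]
  rfl

theorem IsLocalMax.comp_chart_symm {q : M} {F : M → ℝ} (h : IsLocalMax F q) :
    IsLocalMax (F ∘ (extChartAt (𝓡 2) q).symm) (extChartAt (𝓡 2) q q) := by
  have hc := continuousAt_extChartAt_symm (I := 𝓡 2) q
  have ht : Tendsto (extChartAt (𝓡 2) q).symm (𝓝 (extChartAt (𝓡 2) q q)) (𝓝 q) := by
    simpa [ContinuousAt] using hc
  have := ht.eventually h
  simpa [IsLocalMax, IsMaxFilter] using this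

/-- The touching inequality on a surface, in terms of its mean curvature. -/
theorem IsOrientedImmersion.gaussian_touching (h : IsOrientedImmersion ψ N) {q : M} {v : E3}
    (hv : ‖v‖ = 1) (y : (ℝ ∙ v)ᗮ) (α ε : ℝ)
    (hmax : IsLocalMax (fun x => inner ℝ (ψ x) v +
      ε * Real.exp (-α * ‖(ℝ ∙ v)ᗮ.orthogonalProjectionOnto (ψ x) - y‖ ^ 2)) q)
    {ξ : E3} (hξ : ξ = ((ℝ ∙ v)ᗮ.orthogonalProjectionOnto (ψ q) - y : (ℝ ∙ v)ᗮ)) {t : ℝ}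
    (ht : t = 2 * α * (ε *
      Real.exp (-α * ‖(ℝ ∙ v)ᗮ.orthogonalProjectionOnto (ψ q) - y‖ ^ 2))) :
    ∃ μ : ℝ, v - t • ξ = μ • (N q : E3) ∧
      t * (2 * α * (‖ξ‖ ^ 2 - inner ℝ ξ (N q : E3) ^ 2) - (1 + inner ℝ v (N q : E3) ^ 2)) +
        2 * μ * meanCurvature ψ N q ≤ 0 := by
  have hd := h.contMDiff.mfderiv_eq_fderiv_chart q
  have hinj : Function.Injective
      (fderiv ℝ (ψ ∘ (extChartAt (𝓡 2) q).symm) (extChartAt (𝓡 2) q q)) := by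
    rw [← hd]
    exact h.injective_mfderiv q
  have hnor (u : E2) : inner ℝ (fderiv ℝ (ψ ∘ (extChartAt (𝓡 2) q).symm)
      (extChartAt (𝓡 2) q q) u) (N q : E3) = 0 := by
    rw [← hd]
    exact h.normal q u
  refine _root_.gaussian_touching (h.contMDiff.contDiffAt_chart q) hinj
    (norm_eq_of_mem_sphere (N q)) hv hnor y α ε hmax.comp_chart_symm ?_ ?_
  · simpa using hξ
  · simpa using ht

/-- At a local maximum of a linear function the Gauss map is `±` its direction, and the mean
curvature has the corresponding sign. -/
theorem IsOrientedImmersion.of_isLocalMax_inner (h : IsOrientedImmersion ψ N) {q : M} {v : E3}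
    (hv : ‖v‖ = 1) (hmax : IsLocalMax (fun x => inner ℝ (ψ x) v) q) :
    ((N q : E3) = v ∧ meanCurvature ψ N q ≤ 0) ∨ ((N q : E3) = -v ∧ 0 ≤ meanCurvature ψ N q) := by
  -- With `α = ε = 0` there is no barrier and `t = 0`.
  obtain ⟨μ, h1, h2⟩ := h.gaussian_touching (q := q) hv 0 0 0 (by simpa using hmax) rfl rfl
  simp only [mul_zero, zero_mul, zero_smul, sub_zero, zero_add] at h1 h2
  have hμ : |μ| = 1 := by
    have := congrArg norm h1
    rw [hv, norm_smul, norm_eq_of_mem_sphere (N q)] at this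
    simpa using this.symm
  rcases (abs_eq zero_le_one).1 hμ with rfl | rfl
  · left
    exact ⟨by simpa using h1.symm, by linarith⟩
  · right
    exact ⟨by simp [h1], by linarith⟩

/-- The projection of an immersed surface to its tangent plane is a local homeomorphism. -/
theorem IsOrientedImmersion.exists_local_projection_chart (h : IsOrientedImmersion ψ N) {p : M}
    {v : E3} (hv : ‖v‖ = 1) (hN : (N p : E3) = v ∨ (N p : E3) = -v) :
    ∃ e : OpenPartialHomeomorph M (ℝ ∙ v)ᗮ, p ∈ e.source ∧
      ∀ x ∈ e.source, e x = (ℝ ∙ v)ᗮ.orthogonalProjectionOnto (ψ x) := by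
  set P := (ℝ ∙ v)ᗮ.orthogonalProjectionOnto with hP
  set f := ψ ∘ (extChartAt (𝓡 2) p).symm with hf
  set a := extChartAt (𝓡 2) p p with ha
  have hfc : ContDiffAt ℝ 2 f a := h.contMDiff.contDiffAt_chart p
  have hPf : ContDiffAt ℝ 2 (fun x => P (f x)) a := P.contDiff.contDiffAt.comp a hfc
  have hd := h.contMDiff.mfderiv_eq_fderiv_chart p
  -- The tangent plane at `p` is `vᗮ`, so the inverse function theorem will apply.
  have hinj : Function.Injective (P.comp (fderiv ℝ f a)) := by
    rw [injective_iff_map_eq_zero]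
    intro u hu
    have hperp : inner ℝ (fderiv ℝ f a u) v = 0 := by
      have h1 : inner ℝ (fderiv ℝ f a u) (N p : E3) = 0 := by
        rw [← hd]
        exact h.normal p u
      rcases hN with h2 | h2 <;> rw [h2] at h1
      · exact h1
      · simpa using h1
    have hn := norm_sq_projection_orthogonal hv (fderiv ℝ f a u)
    change P (fderiv ℝ f a u) = 0 at hu
    rw [← hP, hu, hperp] at hn
    have h0 : fderiv ℝ f a u = 0 := by simpa using hn.symm
    have hinj' : Function.Injective (fderiv ℝ f a) := by
      rw [← hd]
      exact h.injective_mfderiv p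
    exact hinj' (by rw [h0, map_zero])
  have : Fact (Module.finrank ℝ E3 = 2 + 1) := ⟨by simp⟩
  have hv0 : v ≠ 0 := by
    rintro rfl
    simp at hv
  have hrank : Module.finrank ℝ E2 = Module.finrank ℝ (ℝ ∙ v)ᗮ := by
    rw [Submodule.finrank_orthogonal_span_singleton (n := 2) hv0]
    simp
  let L : E2 ≃L[ℝ] (ℝ ∙ v)ᗮ := (LinearEquiv.ofInjectiveOfFinrankEq
    (P.comp (fderiv ℝ f a) : E2 →ₗ[ℝ] (ℝ ∙ v)ᗮ) hinj hrank).toContinuousLinearEquiv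
  have hL : HasFDerivAt (fun x => P (f x)) (L : E2 →L[ℝ] (ℝ ∙ v)ᗮ) a := by
    have h1 : HasFDerivAt (fun x => P (f x)) (P.comp (fderiv ℝ f a)) a :=
      P.hasFDerivAt.comp a (hfc.differentiableAt (by simp)).hasFDerivAt
    convert! h1 using 1
  let e₀ := hPf.toOpenPartialHomeomorph _ hL (by simp)
  have hmem : a ∈ e₀.source := hPf.mem_toOpenPartialHomeomorph_source hL (by simp)
  refine ⟨(chartAt E2 p).trans e₀, ?_, ?_⟩
  · rw [OpenPartialHomeomorph.trans_source]
    exact ⟨mem_chart_source E2 p, by simpa [ha] using hmem⟩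
  · intro x hx
    rw [OpenPartialHomeomorph.trans_source] at hx
    change P (ψ ((extChartAt (𝓡 2) p).symm (chartAt E2 p x))) = P (ψ x)
    congr 2
    simpa using (chartAt E2 p).left_inv hx.1

end

/-! ### Strong maximum principle -/

/-- The numerical contradiction behind the touching argument. -/
theorem false_of_touching_ineq {α t r i b μ η C R : ℝ} (hα : α = 4 * (3 + 6 * C * R) / R ^ 2)
    (hR : 0 < R) (hC : 0 ≤ C) (ht : 0 < t) (hr₁ : R / 2 ≤ r) (hr₂ : r ≤ 3 * R / 2)
    (htr : t * r < 1) (hμ : μ ^ 2 = 1 + (t * r) ^ 2) (hi : μ * i = -(t * r ^ 2)) (hb : b ^ 2 ≤ 1)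
    (hη : |η| ≤ C * (t * r))
    (h : t * (2 * α * (r ^ 2 - i ^ 2) - (1 + b ^ 2)) + 2 * μ * η ≤ 0) : False := by
  -- Here `r`, `i`, `b`, `η` stand for `‖ξ‖`, `⟪ξ, N⟫`, `⟪v, N⟫` and the mean curvature.
  have hr : 0 < r := by linarith
  have hα0 : 0 < α := by rw [hα]; positivity
  have hτ : (t * r) ^ 2 ≤ 1 := by
    have : 0 < t * r := by positivity
    nlinarith
  have hi2 : i ^ 2 ≤ r ^ 2 / 2 := by
    have h1 : (1 + (t * r) ^ 2) * i ^ 2 = (t * r) ^ 2 * r ^ 2 := by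
      rw [← hμ, ← mul_pow, hi]
      ring
    by_contra! hlt
    have h2 : (1 + (t * r) ^ 2) * (r ^ 2 / 2) < (1 + (t * r) ^ 2) * i ^ 2 := by gcongr
    rw [h1] at h2
    nlinarith [mul_nonneg (sub_nonneg.2 hτ) (sq_nonneg r)]
  have hμ2 : |μ| ≤ 2 := by
    rw [← sq_le_sq₀ (abs_nonneg _) (by norm_num), sq_abs]
    linarith
  have hμη : -(2 * (C * (t * r))) ≤ μ * η := by
    have h1 : |μ * η| ≤ 2 * (C * (t * r)) := by
      rw [abs_mul]
      gcongr
    exact (abs_le.1 h1).1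
  have h1 : α * r ^ 2 ≤ 2 * α * (r ^ 2 - i ^ 2) := by nlinarith
  have h2 : t * (α * r ^ 2 - 2) ≤ t * (2 * α * (r ^ 2 - i ^ 2) - (1 + b ^ 2)) := by
    gcongr
    linarith
  have h3 : t * (α * r ^ 2 - 2 - 4 * C * r) ≤ 0 := by linarith
  have h4 : α * r ^ 2 - 2 - 4 * C * r ≤ 0 := by
    by_contra! hpos
    exact absurd h3 (not_le.2 (mul_pos ht hpos))
  -- `α` is chosen so that `α * r ^ 2 ≥ 3 + 6 * C * R` exceeds `2 + 4 * C * r` throughout the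
  -- annulus.
  have h5 : 3 + 6 * C * R = α * (R / 2) ^ 2 := by
    rw [hα]
    field_simp
    ring
  have h6 : α * (R / 2) ^ 2 ≤ α * r ^ 2 := by gcongr
  have h7 : C * r ≤ C * (3 * R / 2) := by gcongr
  linarith

section

variable {M : Type*} [TopologicalSpace M] [ChartedSpace E2 M] {ψ : M → E3} {N : M → S2}
  {H : S2 → ℝ}

/-- Strong maximum principle: an `H`-surface lying on one side of its tangent plane at a point where
its Gauss map is a zero of `H` agrees locally with that plane. -/
theorem IsHSurface.eventually_eq_of_max (hS : IsHSurface H ψ N)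
    (hH : ContMDiff (𝓡 2) 𝓘(ℝ, ℝ) 1 H) {p : M} {v : E3} (hv : ‖v‖ = 1)
    (hN : (N p : E3) = v ∨ (N p : E3) = -v) (hzero : H (N p) = 0)
    (hmax : ∀ x, inner ℝ (ψ x) v ≤ (inner ℝ (ψ p) v : ℝ)) :
    ∀ᶠ x in 𝓝 p, inner ℝ (ψ x) v = (inner ℝ (ψ p) v : ℝ) := by
  have hor : IsOrientedImmersion ψ N := hS.toIsOrientedImmersion
  have hψ : Continuous ψ := hor.contMDiff.continuous
  obtain ⟨s, hs, hsN⟩ : ∃ s : ℝ, s * s = 1 ∧ (N p : E3) = s • v := by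
    rcases hN with h | h
    · exact ⟨1, by simp, by simpa using h⟩
    · exact ⟨-1, by simp, by simpa using h⟩
  have hs1 : |s| = 1 := by
    rw [← sq_eq_sq₀ (abs_nonneg _) zero_le_one, sq_abs]
    linarith
  obtain ⟨C, hC, δ, hδ, hbound⟩ := exists_gnomonic_bound hH hzero
  obtain ⟨e, hpe, heq⟩ := hor.exists_local_projection_chart hv hN
  -- On `V` the normal stays in the open hemisphere about `N p`, as the gnomonic coordinate
  -- requires.
  set V : Set M := {x | 0 < (inner ℝ (N x : E3) (N p : E3) : ℝ)} with hV
  have hVo : IsOpen V :=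
    isOpen_lt continuous_const
      ((continuous_subtype_val.comp hor.continuous_gauss).inner continuous_const)
  have hpV : p ∈ V := by
    have : ‖(N p : E3)‖ = 1 := norm_eq_of_mem_sphere (N p)
    simp [hV, this]
  have hWo : IsOpen (e.target ∩ e.symm ⁻¹' V) := e.isOpen_inter_preimage_symm hVo
  obtain ⟨ρ, hρ, hball⟩ := Metric.isOpen_iff.1 hWo (e p)
    ⟨e.map_source hpe, by simpa [e.left_inv hpe] using hpV⟩
  set c : ℝ := inner ℝ (ψ p) v with hc
  have key := eqOn_zero_of_no_gaussian_max (u := fun x => inner ℝ (ψ (e.symm x)) v - c)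
    (x₀ := e p) hρ ?_ ?_ ?_ ?_
  · have h1 : ∀ᶠ x in 𝓝 p, e x ∈ ball (e p) (ρ / 4) :=
      (e.continuousAt hpe).eventually (ball_mem_nhds _ (by positivity))
    filter_upwards [h1, e.open_source.mem_nhds hpe] with x hx hxe
    have := key _ hx
    rw [e.left_inv hxe] at this
    linarith
  · have h1 : ContinuousOn e.symm (ball (e p) ρ) :=
      e.continuousOn_symm.mono fun x hx => (hball hx).1
    exact ((hψ.comp_continuousOn h1).inner continuousOn_const).sub continuousOn_const
  · intro x _
    linarith [hmax (e.symm x)]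
  · simp [e.left_inv hpe, hc]
  · intro y R hR
    set α : ℝ := 4 * (3 + 6 * C * R) / R ^ 2 with hα
    have hα0 : 0 < α := by positivity
    -- From `t ≤ 2 * α * ε` and `‖ξ‖ ≤ 3 * R / 2`, this bound on `ε` gives `t * ‖ξ‖ < min 1 δ`.
    refine ⟨α, hα0, min 1 δ / (3 * α * R), by positivity, ?_⟩
    intro ε hε hεlt x hx hxR₁ hxR₂ hloc
    rw [lt_div_iff₀ (by positivity)] at hεlt
    obtain ⟨hxt, hxV⟩ := hball hx
    set q : M := e.symm x with hq
    have hqe : q ∈ e.source := e.map_target hxt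
    have heqx : e q = x := e.right_inv hxt
    have hPq : (ℝ ∙ v)ᗮ.orthogonalProjectionOnto (ψ q) = x := by rw [← heq q hqe, heqx]
    have hlocM : IsLocalMax (fun z => inner ℝ (ψ z) v +
        ε * Real.exp (-α * ‖(ℝ ∙ v)ᗮ.orthogonalProjectionOnto (ψ z) - y‖ ^ 2)) q := by
      have h1 : Tendsto e (𝓝 q) (𝓝 x) := heqx ▸ e.continuousAt hqe
      filter_upwards [h1.eventually hloc, e.open_source.mem_nhds hqe] with z hz hze
      simp only [e.left_inv hze] at hz
      simp only [heq z hze] at hz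
      rw [hPq]
      linarith
    obtain ⟨μ, h1, h2⟩ := hor.gaussian_touching hv y α ε hlocM rfl rfl
    rw [hPq, hS.meanCurvature_eq] at h2
    rw [hPq] at h1
    set t : ℝ := 2 * α * (ε * Real.exp (-α * ‖x - y‖ ^ 2)) with ht
    set ξ : E3 := ((x - y : (ℝ ∙ v)ᗮ) : E3) with hξ
    have hξn : ‖x - y‖ = ‖ξ‖ := rfl
    have hξv : inner ℝ ξ v = (0 : ℝ) := by
      rw [real_inner_comm]
      exact Submodule.mem_orthogonal_singleton_iff_inner_right.1 (x - y).2
    have hvξ : inner ℝ v ξ = (0 : ℝ) := by rw [real_inner_comm, hξv]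
    have hvv : inner ℝ v v = (1 : ℝ) := by simp [hv]
    have hNq : ‖(N q : E3)‖ = 1 := norm_eq_of_mem_sphere (N q)
    have ht0 : 0 < t := by positivity
    have htle : t ≤ 2 * α * ε := by
      have : Real.exp (-α * ‖x - y‖ ^ 2) ≤ 1 := by
        rw [Real.exp_le_one_iff]
        nlinarith [sq_nonneg ‖x - y‖]
      calc t ≤ 2 * α * (ε * 1) := by rw [ht]; gcongr
        _ = 2 * α * ε := by ring
    rw [hξn] at hxR₁ hxR₂
    have htr : t * ‖ξ‖ < min 1 δ := by
      calc t * ‖ξ‖ ≤ 2 * α * ε * (3 * R / 2) := by gcongr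
        _ = ε * (3 * α * R) := by ring
        _ < min 1 δ := hεlt
    have hμN : μ * inner ℝ v (N q : E3) = 1 := by
      rw [← inner_smul_right, ← h1, inner_sub_right, inner_smul_right, hvξ, hvv]
      ring
    have hμ2 : μ ^ 2 = 1 + (t * ‖ξ‖) ^ 2 := by
      have h3 : inner ℝ (v - t • ξ) (v - t • ξ) = (inner ℝ (μ • (N q : E3)) (μ • (N q : E3)) : ℝ) :=
        by rw [h1]
      simp only [inner_sub_left, inner_sub_right, inner_smul_left, inner_smul_right, hvξ, hξv, hvv,
        real_inner_self_eq_norm_sq, hNq, RCLike.conj_to_real] at h3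
      linear_combination -h3
    have hμi : μ * inner ℝ ξ (N q : E3) = -(t * ‖ξ‖ ^ 2) := by
      rw [← inner_smul_right, ← h1, inner_sub_right, inner_smul_right, hξv,
        real_inner_self_eq_norm_sq]
      ring
    have hb : (inner ℝ v (N q : E3) : ℝ) ^ 2 ≤ 1 := by
      have := abs_real_inner_le_norm v (N q : E3)
      rw [hv, hNq, one_mul] at this
      exact (sq_le_one_iff_abs_le_one _).2 this
    have hsμ : 0 < s * μ := by
      have h3 : 0 < (inner ℝ (N q : E3) (N p : E3) : ℝ) := hxV
      rw [hsN, inner_smul_right, real_inner_comm] at h3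
      have h4 : s * μ * (s * inner ℝ v (N q : E3)) = 1 := by
        linear_combination (s * s) * hμN + hs
      by_contra! hneg
      nlinarith
    have hzn : ‖(-(s * t)) • ξ‖ = t * ‖ξ‖ := by
      rw [norm_smul, norm_neg, norm_mul, Real.norm_eq_abs, Real.norm_eq_abs, hs1, one_mul,
        abs_of_pos ht0]
    have hη : |H (N q)| ≤ C * (t * ‖ξ‖) := by
      rw [← hzn]
      -- Multiplying `v - t • ξ = μ • N q` by `s` shows that `N q` has gnomonic coordinate `-(s * t)
      -- • ξ` about `N p`.
      refine hbound (N q) _ (s * μ) ?_ ?_ hsμ ?_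
      · rw [hzn]
        exact htr.trans_le (min_le_right _ _)
      · rw [hsN, inner_smul_left, inner_smul_right, hξv]
        simp
      · rw [mul_smul, ← h1, hsN]
        module
    exact false_of_touching_ineq hα hR hC ht0 hxR₁ hxR₂ (htr.trans_le (min_le_left _ _)) hμ2 hμi
      hb hη h2

/-- A compact `H`-surface cannot lie on one side of its tangent plane at a point where its Gauss map
is a zero of `H`. -/
theorem IsHSurface.false_of_max [CompactSpace M] (hS : IsHSurface H ψ N)
    (hH : ContMDiff (𝓡 2) 𝓘(ℝ, ℝ) 1 H) {p : M} {v : E3} (hv : ‖v‖ = 1)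
    (hN : (N p : E3) = v ∨ (N p : E3) = -v) (hzero : H (N p) = 0)
    (hmax : ∀ x, inner ℝ (ψ x) v ≤ (inner ℝ (ψ p) v : ℝ)) : False := by
  have hor : IsOrientedImmersion ψ N := hS.toIsOrientedImmersion
  have hψ : Continuous ψ := hor.contMDiff.continuous
  set A : Set M := {x | inner ℝ (ψ x) v = (inner ℝ (ψ p) v : ℝ)} ∩ {x | N x = N p} with hA
  have hAclosed : IsClosed A :=
    (isClosed_eq (hψ.inner continuous_const) continuous_const).inter
      (isClosed_eq hor.continuous_gauss continuous_const)
  have hAopen : IsOpen A := by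
    rw [isOpen_iff_mem_nhds]
    rintro q ⟨hq₁ : inner ℝ (ψ q) v = (inner ℝ (ψ p) v : ℝ), hq₂ : N q = N p⟩
    have h1 := hS.eventually_eq_of_max hH (p := q) hv (hq₂ ▸ hN) (hq₂ ▸ hzero)
      (fun x => hq₁ ▸ hmax x)
    have h2 : ∀ᶠ x in 𝓝 q, 0 < (inner ℝ (N x : E3) (N p : E3) : ℝ) := by
      have hc : Continuous fun x => (inner ℝ (N x : E3) (N p : E3) : ℝ) :=
        (continuous_subtype_val.comp hor.continuous_gauss).inner continuous_const
      refine hc.continuousAt.eventually_const_lt ?_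
      have : ‖(N p : E3)‖ = 1 := norm_eq_of_mem_sphere (N p)
      simp [hq₂, this]
    filter_upwards [h1, h2] with x hx₁ hx₂
    refine ⟨hx₁.trans hq₁, ?_⟩
    have hlm : IsLocalMax (fun z => inner ℝ (ψ z) v) x :=
      Eventually.of_forall fun z => by
        simpa only [hx₁, hq₁] using hmax z
    have hNx : (N x : E3) = v ∨ (N x : E3) = -v :=
      (hor.of_isLocalMax_inner hv hlm).imp And.left And.left
    ext1
    rcases hN with h | h <;> rcases hNx with h' | h' <;> rw [h, h'] at hx₂ ⊢ <;>
      simp [hv] at hx₂ <;> linarith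
  have : Fact (Module.finrank ℝ E3 = 2 + 1) := ⟨by simp⟩
  have hv0 : v ≠ 0 := by
    rintro rfl
    simp at hv
  have hrank : Module.finrank ℝ (ℝ ∙ v)ᗮ = 2 :=
    Submodule.finrank_orthogonal_span_singleton (n := 2) hv0
  have : Nontrivial (ℝ ∙ v)ᗮ := Module.nontrivial_of_finrank_pos (R := ℝ) (by omega)
  obtain ⟨w, hw⟩ := exists_norm_eq (ℝ ∙ v)ᗮ (zero_le_one (α := ℝ))
  have hw' : ‖(w : E3)‖ = 1 := hw
  have hvw : inner ℝ v (w : E3) = (0 : ℝ) :=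
    Submodule.mem_orthogonal_singleton_iff_inner_right.1 w.2
  -- Since `A` is open, this maximum on `A` is a local maximum on `M`, forcing `N q = ±w`,
  -- orthogonal to `v`.
  obtain ⟨q, hqA, hq⟩ := hAclosed.isCompact.exists_isMaxOn ⟨p, rfl, rfl⟩
    (hψ.inner (𝕜 := ℝ) (continuous_const (y := (w : E3)))).continuousOn
  have hNq := hor.of_isLocalMax_inner hw' (hq.isLocalMax (hAopen.mem_nhds hqA))
  have hvNq : inner ℝ v (N q : E3) = (0 : ℝ) := by
    rcases hNq with h | h <;> simp [h.1, hvw]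
  rw [hqA.2] at hvNq
  rcases hN with h | h <;> simp [h, hv0] at hvNq

end

theorem proposition2p4 (H : S2 → ℝ) (hH : ContMDiff (𝓡 2) 𝓘(ℝ, ℝ) 1 H)
    (hzero : ∃ v : S2, H v = 0)
    (M : Type*) [TopologicalSpace M] [T2Space M] [CompactSpace M] [Nonempty M]
    [ChartedSpace E2 M] [IsManifold (𝓡 2) 2 M] :
    ¬ ∃ (ψ : M → E3) (N : M → S2), IsHSurface H ψ N := by
  rintro ⟨ψ, N, hS⟩
  obtain ⟨v, hv⟩ := hzero
  have hor : IsOrientedImmersion ψ N := hS.toIsOrientedImmersion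
  have hψ : Continuous ψ := hor.contMDiff.continuous
  have hv1 : ‖(v : E3)‖ = 1 := norm_eq_of_mem_sphere v
  have hv1' : ‖-(v : E3)‖ = 1 := by rw [norm_neg, hv1]
  -- at the two extrema of the height, the Gauss map is `± v`
  obtain ⟨p, -, hp⟩ := isCompact_univ.exists_isMaxOn univ_nonempty
    (hψ.inner (𝕜 := ℝ) (continuous_const (y := (v : E3)))).continuousOn
  obtain ⟨q, -, hq⟩ := isCompact_univ.exists_isMaxOn univ_nonempty
    (hψ.inner (𝕜 := ℝ) (continuous_const (y := -(v : E3)))).continuousOn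
  have hp' (x) : inner ℝ (ψ x) (v : E3) ≤ (inner ℝ (ψ p) (v : E3) : ℝ) := hp (mem_univ x)
  have hq' (x) : inner ℝ (ψ x) (-(v : E3)) ≤ (inner ℝ (ψ q) (-(v : E3)) : ℝ) := hq (mem_univ x)
  have hNp := hor.of_isLocalMax_inner hv1 (hp.isLocalMax univ_mem)
  have hNq := hor.of_isLocalMax_inner hv1' (hq.isLocalMax univ_mem)
  rw [hS.meanCurvature_eq] at hNp hNq
  rcases hNp with ⟨h1, -⟩ | ⟨h1, h2⟩
  · exact hS.false_of_max hH hv1 (Or.inl h1) (by rwa [Subtype.ext h1]) hp'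
  · rcases hNq with ⟨h3, h4⟩ | ⟨h3, -⟩
    · have hpq : N p = N q := Subtype.ext (h1.trans h3.symm)
      rw [← hpq] at h4
      exact hS.false_of_max hH hv1 (Or.inr h1) (le_antisymm h4 h2) hp'
    · rw [neg_neg] at h3
      exact hS.false_of_max hH hv1' (Or.inr (by rwa [neg_neg])) (by rwa [Subtype.ext h3]) hq'
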